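/- All rings are associative with $1\neq 0$. A unary pp formula for left $R$-modules is a formula $\varphi(x)=\exists\,\bar y\,(\mathfrak A\bar y=\mathfrak b x)$ with finite matrices $\mathfrak A,\mathfrak b$ over $R$; $\varphi(M)$ denotes the set of its solutions in a module $M$. A module is absolutely pure if it is a pure submodule of every module containing it. The formula $\varphi$ is called high if $\varphi(N)=N$ for every absolutely pure module $N$, low if $\varphi(F)=0$ for every flat module $F$, and high-low if it is both; likewise for right pp formulas and right modules. To say that $R$ has no high-low formula means that no unary pp formula, left or right, is high-low over $R$. An extension of right $R$-modules $A\subseteq B$ is rational if for all $b_0,b_1\in B$ with $b_1\neq 0$ there is $s\in R$ with $b_1s\neq 0$ and $b_0s\in A$. A module is nonsingular if no annihilator of a nonzero element is an essential one-sided ideal, and $R$ is right nonsingular if $R_R$ is nonsingular. For right nonsingular $R$, the maximal right quotient ring of $R$ is the ring extension $Q\supseteq R$ for which $Q_R$ is an injective hull of $R_R$. 1. Let $R\subseteq Q$ be a ring extension such that $R_R\subseteq Q_R$ is rational, and suppose that the left $R$-module ${}_RQ$ is absolutely pure. Then $R$ has no high-low formula. 2. In particular, let $R$ be right nonsingular with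 maximal right quotient ring $Q$, and suppose that ${}_RQ$ is absolutely pure. Then $R$ has no high-low formula. 3. In particular, no nonzero commutative nonsingular ring has a high-low formula. -/

import Mathlib

open scoped MulOpposite TensorProduct

universe u v w

/-! Right modules over a ring `R` are modules over `Rᵐᵒᵖ`, with `x r` written `MulOpposite.op r • x`. -/

section Formulas

/-- An `n`-place pp formula `∃ y (A y = B x)` for left `R`-modules, given by its matrices.
A right pp formula `∃ y (y C = x D)` over `R` is a `PPFormula Rᵐᵒᵖ n`. -/
structure PPFormula (R : Type u) (n : ℕ) where
  rows : ℕ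
  bound : ℕ
  A : Matrix (Fin rows) (Fin bound) R
  B : Matrix (Fin rows) (Fin n) R

/-- The tuple `x` satisfies the formula in the module containing it. -/
def PPFormula.Realize {R : Type u} [Ring R] {M : Type v} [AddCommGroup M] [Module R M] {n : ℕ}
    (φ : PPFormula R n) (x : Fin n → M) : Prop :=
  ∃ y : Fin φ.bound → M, ∀ i, ∑ j, φ.A i j • y j = ∑ j, φ.B i j • x j

/-- The subset `φ(M)` of `M` defined by a unary pp formula. -/
def PPFormula.solutions {R : Type u} [Ring R] (φ : PPFormula R 1)
    (M : Type v) [AddCommGroup M] [Module R M] : Set M :=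
  {a | φ.Realize (fun _ : Fin 1 => a)}

end Formulas

section Purity

/-- A pure embedding of left modules: pp formulas that hold in `N` of a tuple from `M`
already hold in `M`. -/
def IsPureEmbedding {R : Type u} [Ring R] {M : Type v} {N : Type w} [AddCommGroup M] [Module R M]
    [AddCommGroup N] [Module R N] (f : M →ₗ[R] N) : Prop :=
  Function.Injective f ∧
    ∀ (n : ℕ) (φ : PPFormula R n) (x : Fin n → M), φ.Realize (fun i => f (x i)) → φ.Realize x

/-- A module is absolutely pure if it is pure in every module that contains it. -/
def IsAbsolutelyPure (R : Type u) [Ring R] (M : Type u) [AddCommGroup M] [Module R M] : Prop :=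
  ∀ (N : Type u) [AddCommGroup N] [Module R N] (f : M →ₗ[R] N),
    Function.Injective f → IsPureEmbedding f

end Purity

section Flatness

/-- The relations `x r ⊗ m = x ⊗ r m`. -/
def balancedRelations (R : Type u) [Ring R] (X : Type v) (M : Type w)
    [AddCommGroup X] [Module Rᵐᵒᵖ X] [AddCommGroup M] [Module R M] : AddSubgroup (X ⊗[ℤ] M) :=
  AddSubgroup.closure
    {t | ∃ (x : X) (r : R) (m : M), t = (MulOpposite.op r • x) ⊗ₜ[ℤ] m - x ⊗ₜ[ℤ] (r • m)}

/-- The tensor product `X ⊗_R M` of a right module `X` and a left module `M` over an arbitrary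
ring `R`, as an abelian group. -/
abbrev BalancedTensor (R : Type u) [Ring R] (X : Type v) (M : Type w)
    [AddCommGroup X] [Module Rᵐᵒᵖ X] [AddCommGroup M] [Module R M] : Type (max v w) :=
  (X ⊗[ℤ] M) ⧸ balancedRelations R X M

theorem balancedRelations_le_comap (R : Type u) [Ring R] {X Y : Type v} (M : Type w)
    [AddCommGroup X] [Module Rᵐᵒᵖ X] [AddCommGroup Y] [Module Rᵐᵒᵖ Y] [AddCommGroup M] [Module R M]
    (f : X →ₗ[Rᵐᵒᵖ] Y) :
    balancedRelations R X M ≤ (balancedRelations R Y M).comap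
      (LinearMap.rTensor M f.toAddMonoidHom.toIntLinearMap).toAddMonoidHom := by
  refine (AddSubgroup.closure_le _).2 ?_
  rintro _ ⟨x, r, m, rfl⟩
  refine AddSubgroup.subset_closure ⟨f x, r, m, ?_⟩
  simp

/-- The map `f ⊗ M : X ⊗_R M → Y ⊗_R M`. -/
def BalancedTensor.map (R : Type u) [Ring R] {X Y : Type v} (M : Type w)
    [AddCommGroup X] [Module Rᵐᵒᵖ X] [AddCommGroup Y] [Module Rᵐᵒᵖ Y] [AddCommGroup M] [Module R M]
    (f : X →ₗ[Rᵐᵒᵖ] Y) : BalancedTensor R X M →+ BalancedTensor R Y M :=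
  QuotientAddGroup.map _ _ (LinearMap.rTensor M f.toAddMonoidHom.toIntLinearMap).toAddMonoidHom
    (balancedRelations_le_comap R M f)

/-- A left module is flat if tensoring with it preserves injectivity of maps of right modules. -/
def IsFlatModule (R : Type u) [Ring R] (M : Type u) [AddCommGroup M] [Module R M] : Prop :=
  ∀ (X Y : Type u) [AddCommGroup X] [Module Rᵐᵒᵖ X] [AddCommGroup Y] [Module Rᵐᵒᵖ Y]
    (f : X →ₗ[Rᵐᵒᵖ] Y), Function.Injective f → Function.Injective (BalancedTensor.map R M f)

end Flatness

section HighLow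

/-- A unary pp formula is high if `φ(N) = N` for every absolutely pure module `N`. -/
def PPFormula.IsHigh {R : Type u} [Ring R] (φ : PPFormula R 1) : Prop :=
  ∀ (N : Type u) [AddCommGroup N] [Module R N], IsAbsolutelyPure R N →
    φ.solutions N = Set.univ

/-- A unary pp formula is low if `φ(F) = 0` for every flat module `F`. -/
def PPFormula.IsLow {R : Type u} [Ring R] (φ : PPFormula R 1) : Prop :=
  ∀ (F : Type u) [AddCommGroup F] [Module R F], IsFlatModule R F →
    φ.solutions F = {0}

/-- Both high and low. -/
def PPFormula.IsHighLow {R : Type u} [Ring R] (φ : PPFormula R 1) : Prop :=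
  φ.IsHigh ∧ φ.IsLow

/-- `R` has no high-low unary pp formula, neither for left nor for right modules. -/
def HasNoHighLowFormula (R : Type u) [Ring R] : Prop :=
  (∀ φ : PPFormula R 1, ¬ φ.IsHighLow) ∧ (∀ ψ : PPFormula Rᵐᵒᵖ 1, ¬ ψ.IsHighLow)

end HighLow

section Quotients

/-- A submodule that meets every nonzero submodule nontrivially. -/
def IsEssentialSubmodule {S : Type u} [Ring S] {M : Type v} [AddCommGroup M] [Module S M]
    (N : Submodule S M) : Prop :=
  ∀ K : Submodule S M, N ⊓ K = ⊥ → K = ⊥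

/-- A module is nonsingular if no annihilator of a nonzero element is an essential ideal. -/
def IsNonsingularModule (S : Type u) [Ring S] (M : Type v) [AddCommGroup M] [Module S M] : Prop :=
  ∀ m : M, m ≠ 0 → ¬ IsEssentialSubmodule (Ideal.torsionOf S M m)

/-- `R` is right nonsingular if the right module `R_R` is nonsingular. -/
def IsRightNonsingular (R : Type u) [Ring R] : Prop :=
  IsNonsingularModule Rᵐᵒᵖ R

/-- A rational (dense) extension `A ⊆ B` of right `R`-modules, given by an embedding. -/
def IsRationalExtension {R : Type u} [Ring R] {A : Type v} {B : Type w} [AddCommGroup A]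
    [Module Rᵐᵒᵖ A] [AddCommGroup B] [Module Rᵐᵒᵖ B] (f : A →ₗ[Rᵐᵒᵖ] B) : Prop :=
  Function.Injective f ∧
    ∀ b₀ b₁ : B, b₁ ≠ 0 →
      ∃ s : R, MulOpposite.op s • b₁ ≠ 0 ∧ MulOpposite.op s • b₀ ∈ LinearMap.range f

/-- An embedding `f : A → E` that makes `E` an injective hull of `A`. -/
def IsInjectiveHull {S : Type u} [Ring S] {A E : Type u} [AddCommGroup A] [Module S A]
    [AddCommGroup E] [Module S E] (f : A →ₗ[S] E) : Prop :=
  Function.Injective f ∧ IsEssentialSubmodule (LinearMap.range f) ∧ Module.Injective S E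

/-- The additive group of `Q`, as a left and a right `R`-module via `f : R → Q`. -/
def RestrictAlong {R : Type u} {Q : Type v} [Ring R] [Ring Q] (_f : R →+* Q) : Type v := Q

instance RestrictAlong.instAddCommGroup {R : Type u} {Q : Type v} [Ring R] [Ring Q] (f : R →+* Q) :
    AddCommGroup (RestrictAlong f) :=
  inferInstanceAs (AddCommGroup Q)

/-- `_RQ`, with `r • q = f r * q`. -/
instance RestrictAlong.instModuleLeft {R : Type u} {Q : Type v} [Ring R] [Ring Q] (f : R →+* Q) :
    Module R (RestrictAlong f) :=
  Module.compHom Q f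

/-- `Q_R`, with `op r • q = q * f r`. -/
instance RestrictAlong.instModuleRight {R : Type u} {Q : Type v} [Ring R] [Ring Q] (f : R →+* Q) :
    Module Rᵐᵒᵖ (RestrictAlong f) :=
  Module.compHom Q f.op

/-- The ring homomorphism `f`, as a map of right modules `R_R → Q_R`. -/
def RestrictAlong.rightMap {R : Type u} {Q : Type v} [Ring R] [Ring Q] (f : R →+* Q) :
    R →ₗ[Rᵐᵒᵖ] RestrictAlong f where
  toFun := f
  map_add' := f.map_add
  map_smul' s r := f.map_mul r s.unop

/-- For a right nonsingular ring `R`: `f` makes `Q` the maximal right quotient ring of `R`,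
that is, a ring extension whose underlying right `R`-module is the injective hull of `R_R`. -/
def IsMaximalRightQuotientRing {R Q : Type u} [Ring R] [Ring Q] (f : R →+* Q) : Prop :=
  IsInjectiveHull (RestrictAlong.rightMap f)

end Quotients

/-!
Elementary duality `ψ ↦ ψ.dual` turns right formulas into left ones and exchanges high with low, so
only left formulas need to be excluded. Let `φ` be a high-low left formula.

If `R_R ⊆ Q_R` is rational and `_RQ` is absolutely pure, then `1 ∈ φ(Q)` because `φ` is high. A
common right denominator `s ≠ 0` of the finitely many witnesses gives `s ∈ φ(R)`. But `R` is flat,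
so `φ(R) = 0` because `φ` is low. An essential extension of a nonsingular module is rational, which
covers the maximal right quotient ring of a right nonsingular ring.

If some nonzero module `K` is both flat and absolutely pure, then `K = φ(K) = 0`, which is absurd.
A commutative nonsingular ring is reduced, so its localization at a minimal prime is a field, and
this field is such a module.
-/

/-! ### Solutions of pp formulas -/

theorem PPFormula.mem_solutions_iff {R : Type u} [Ring R] (φ : PPFormula R 1) {M : Type v}
    [AddCommGroup M] [Module R M] {a : M} :
    a ∈ φ.solutions M ↔ ∃ y : Fin φ.bound → M, ∀ i, ∑ j, φ.A i j • y j = φ.B i 0 • a := by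
  simp [PPFormula.solutions, PPFormula.Realize]

theorem PPFormula.Realize.map {R : Type u} [Ring R] {M : Type v} {N : Type w} [AddCommGroup M]
    [Module R M] [AddCommGroup N] [Module R N] (f : M →ₗ[R] N) {n : ℕ} {φ : PPFormula R n}
    {x : Fin n → M} (h : φ.Realize x) : φ.Realize (fun i => f (x i)) := by
  obtain ⟨y, hy⟩ := h
  exact ⟨fun j => f (y j), fun i => by simpa using congrArg f (hy i)⟩

/-! ### Injective and absolutely pure modules -/

theorem IsPureEmbedding.of_leftInverse {R : Type u} [Ring R] {M : Type v} {N : Type w}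
    [AddCommGroup M] [Module R M] [AddCommGroup N] [Module R N] {f : M →ₗ[R] N} {g : N →ₗ[R] M}
    (h : Function.LeftInverse g f) : IsPureEmbedding f := by
  refine ⟨h.injective, fun n φ x hx => ?_⟩
  simpa only [h _] using hx.map g

theorem IsAbsolutelyPure.of_injective {R : Type u} [Ring R] {M : Type u} [AddCommGroup M]
    [Module R M] (hM : Module.Injective R M) : IsAbsolutelyPure R M := by
  intro N _ _ f hf
  obtain ⟨g, hg⟩ := hM.out f hf LinearMap.id
  exact .of_leftInverse hg

theorem exists_injective_linearMap_to_injective (R : Type u) [Ring R] (M : Type u) [AddCommGroup M]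
    [Module R M] : ∃ (E : Type u) (_ : AddCommGroup E) (_ : Module R E) (i : M →ₗ[R] E),
      Function.Injective i ∧ Module.Injective R E := by
  obtain ⟨⟨J, _, i, hi⟩⟩ := CategoryTheory.EnoughInjectives.presentation (ModuleCat.of R M)
  exact ⟨J, inferInstance, inferInstance, i.hom, (ModuleCat.mono_iff_injective i).1 hi,
    Module.injective_module_of_injective_object R J⟩

theorem exists_comp_eq_of_ker_le_ker {R : Type u} [Ring R] {E : Type u} [AddCommGroup E]
    [Module R E] [Module.Injective R E] {P : Type v} {P' : Type w} [AddCommGroup P] [Module R P]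
    [AddCommGroup P'] [Module R P'] (a : P →ₗ[R] P') (b : P →ₗ[R] E)
    (h : LinearMap.ker a ≤ LinearMap.ker b) : ∃ g : P' →ₗ[R] E, g ∘ₗ a = b := by
  obtain ⟨g, hg⟩ := Module.Injective.extension_property R _ _ _
    ((LinearMap.ker a).liftQ a le_rfl)
    (LinearMap.ker_eq_bot.1 (Submodule.ker_liftQ_eq_bot _ _ _ le_rfl))
    ((LinearMap.ker a).liftQ b h)
  refine ⟨g, ?_⟩
  rw [← Submodule.liftQ_mkQ _ a le_rfl, ← LinearMap.comp_assoc, hg, Submodule.liftQ_mkQ]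

/-- The system `A y = B x` in the unknowns `y` is consistent: every linear relation among the rows
of `A` is satisfied by the right-hand sides. This is the obvious necessary condition for `φ` to
hold of `x` in some extension of `M`. -/
def PPFormula.IsConsistentAt {R : Type u} [Ring R] {M : Type v} [AddCommGroup M] [Module R M]
    {n : ℕ} (φ : PPFormula R n) (x : Fin n → M) : Prop :=
  ∀ r : Fin φ.rows → R, Matrix.vecMul r φ.A = 0 → ∑ i, r i • ∑ j, φ.B i j • x j = 0

theorem PPFormula.IsConsistentAt.realize_map {R : Type u} [Ring R] {M : Type v} [AddCommGroup M]
    [Module R M] {n : ℕ} {φ : PPFormula R n} {x : Fin n → M} (h : φ.IsConsistentAt x)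
    {E : Type u} [AddCommGroup E] [Module R E] [Module.Injective R E] (i : M →ₗ[R] E) :
    φ.Realize (fun j => i (x j)) := by
  let b : (Fin φ.rows → R) →ₗ[R] M := Fintype.linearCombination R fun k => ∑ j, φ.B k j • x j
  have hker : LinearMap.ker φ.A.vecMulLinear ≤ LinearMap.ker (i ∘ₗ b) := fun r hr => by
    have hb : b r = 0 := h r hr
    simp [hb]
  obtain ⟨g, hg⟩ := exists_comp_eq_of_ker_le_ker _ _ hker
  refine ⟨fun j => g (Pi.single j 1), fun k => ?_⟩
  calc ∑ j, φ.A k j • g (Pi.single j 1) = g (φ.A k) := by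
        conv_rhs => rw [pi_eq_sum_univ' (φ.A k)]
        simp only [map_sum, map_smul]
    _ = i (b (Pi.single k 1)) := by
        rw [← LinearMap.comp_apply i b, ← hg]; simp [Matrix.row_def]
    _ = ∑ j, φ.B k j • i (x j) := by simp [b]

theorem IsAbsolutelyPure.realize {R : Type u} [Ring R] {N : Type u} [AddCommGroup N] [Module R N]
    (hN : IsAbsolutelyPure R N) {n : ℕ} {φ : PPFormula R n} {x : Fin n → N}
    (h : φ.IsConsistentAt x) : φ.Realize x := by
  obtain ⟨E, _, _, i, hi, _⟩ := exists_injective_linearMap_to_injective R N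
  exact (hN E i hi).2 n φ x (h.realize_map i)

theorem injective_of_flat_algebra {R S : Type u} [CommRing R] [CommRing S] [Algebra R S]
    [Module.Flat R S] (E : Type u) [AddCommGroup E] [Module R E] [Module S E] [IsScalarTower R S E]
    [Module.Injective S E] : Module.Injective R E where
  out X Y _ _ _ _ f hf g := by
    obtain ⟨h, hh⟩ := Module.Injective.out (f.baseChange S)
      (Module.Flat.lTensor_preserves_injective_linearMap f hf) (g.liftBaseChange S)
    refine ⟨h.restrictScalars R ∘ₗ TensorProduct.mk R S Y 1, fun x => ?_⟩
    simpa using hh (1 ⊗ₜ x)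

/-! ### Balanced tensor products and flatness -/

namespace BalancedTensor

section

variable (R : Type u) [Ring R] {X Y : Type v} {M : Type w} [AddCommGroup X] [Module Rᵐᵒᵖ X]
  [AddCommGroup Y] [Module Rᵐᵒᵖ Y] [AddCommGroup M] [Module R M]

/-- The pure tensor `x ⊗ m` in `X ⊗_R M`, as a biadditive map. -/
def tmul : X →+ M →+ BalancedTensor R X M :=
  (LinearMap.toAddMonoidHom'.comp (TensorProduct.mk ℤ X M).toAddMonoidHom).compr₂
    (QuotientAddGroup.mk' (balancedRelations R X M))

theorem tmul_smul (x : X) (r : R) (m : M) :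
    tmul R x (r • m) = tmul R (MulOpposite.op r • x) m :=
  QuotientAddGroup.eq_iff_sub_mem.2 <| by
    rw [← neg_sub]
    exact neg_mem (AddSubgroup.subset_closure ⟨x, r, m, rfl⟩)

theorem map_tmul (f : X →ₗ[Rᵐᵒᵖ] Y) (x : X) (m : M) :
    map R M f (tmul R x m) = tmul R (f x) m :=
  rfl

variable {R}

theorem hom_ext {G : Type*} [AddCommGroup G] {g h : BalancedTensor R X M →+ G}
    (hgh : ∀ x m, g (tmul R x m) = h (tmul R x m)) : g = h := by
  refine QuotientAddGroup.addMonoidHom_ext _ (AddMonoidHom.ext fun t => ?_)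
  induction t with
  | zero => simp only [map_zero]
  | tmul x m => exact hgh x m
  | add s t hs ht => simp only [map_add, hs, ht]

/-- The map `x ⊗ m ↦ b x m` out of `X ⊗_R M` given by a balanced biadditive map `b`. -/
def lift {G : Type*} [AddCommGroup G] (b : X →+ M →+ G)
    (hb : ∀ x (r : R) m, b (MulOpposite.op r • x) m = b x (r • m)) : BalancedTensor R X M →+ G :=
  QuotientAddGroup.lift _ (TensorProduct.liftAddHom b fun n x m => by simp) <|
    (AddSubgroup.closure_le _).2 <| by
      rintro _ ⟨x, r, m, rfl⟩
      simp [hb]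

theorem lift_tmul {G : Type*} [AddCommGroup G] (b : X →+ M →+ G)
    (hb : ∀ x (r : R) m, b (MulOpposite.op r • x) m = b x (r • m)) (x : X) (m : M) :
    lift b hb (tmul R x m) = b x m :=
  rfl

end

section

variable (R : Type u) [Ring R]

/-- The canonical isomorphism `X ⊗_R R ≃ X`. -/
def rid (X : Type v) [AddCommGroup X] [Module Rᵐᵒᵖ X] : BalancedTensor R X R ≃+ X :=
  AddMonoidHom.toAddEquiv
    (lift ((smulAddHom Rᵐᵒᵖ X).comp (MulOpposite.opAddEquiv : R ≃+ Rᵐᵒᵖ).toAddMonoidHom).flip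
      fun x r m => by simp [mul_smul])
    ((tmul R).flip 1)
    (hom_ext fun x r => by simp [lift_tmul, ← tmul_smul])
    (AddMonoidHom.ext fun x => by simp [lift_tmul])

theorem rid_map {X Y : Type v} [AddCommGroup X] [Module Rᵐᵒᵖ X] [AddCommGroup Y] [Module Rᵐᵒᵖ Y]
    (f : X →ₗ[Rᵐᵒᵖ] Y) (t : BalancedTensor R X R) : rid R Y (map R R f t) = f (rid R X t) := by
  obtain ⟨x, rfl⟩ := (rid R X).symm.surjective t
  rw [AddEquiv.apply_symm_apply, ← AddEquiv.eq_symm_apply]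
  rfl

theorem one_tmul_injective (M : Type w) [AddCommGroup M] [Module R M] :
    Function.Injective (tmul R (1 : R) : M →+ BalancedTensor R R M) := by
  let lid : BalancedTensor R R M →+ M := lift (smulAddHom R M) fun x r m => by simp [mul_smul]
  exact Function.LeftInverse.injective (g := lid) fun m =>
    (lift_tmul _ _ _ _).trans (one_smul R m)

end

end BalancedTensor

theorem isFlatModule_self (R : Type u) [Ring R] : IsFlatModule R R := by
  intro X Y _ _ _ _ f hf s t hst
  refine (BalancedTensor.rid R X).injective (hf ?_)
  rw [← BalancedTensor.rid_map, ← BalancedTensor.rid_map, hst]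

/-- Over a commutative ring `X ⊗_R M` is the usual tensor product. -/
def BalancedTensor.equivTensorProduct {R : Type u} [CommRing R] (X : Type v) (M : Type w)
    [AddCommGroup X] [Module R X] [Module Rᵐᵒᵖ X] [IsCentralScalar R X] [AddCommGroup M]
    [Module R M] : BalancedTensor R X M ≃+ X ⊗[R] M :=
  AddMonoidHom.toAddEquiv
    (lift (LinearMap.toAddMonoidHom'.comp (TensorProduct.mk R X M).toAddMonoidHom)
      fun x r m => by simp)
    (TensorProduct.liftAddHom (tmul R) fun r x m => by rw [tmul_smul, op_smul_eq_smul])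
    (hom_ext fun x m => rfl)
    (AddMonoidHom.ext fun t => by
      induction t with
      | zero => simp only [map_zero]
      | tmul x m => rfl
      | add s t hs ht => simp only [map_add, hs, ht])

theorem BalancedTensor.equivTensorProduct_map {R : Type u} [CommRing R] {X Y : Type v} {M : Type w}
    [AddCommGroup X] [Module R X] [Module Rᵐᵒᵖ X] [IsCentralScalar R X] [AddCommGroup Y]
    [Module R Y] [Module Rᵐᵒᵖ Y] [IsCentralScalar R Y] [AddCommGroup M] [Module R M]
    (f : X →ₗ[Rᵐᵒᵖ] Y) (g : X →ₗ[R] Y) (hfg : ∀ x, f x = g x) (t : BalancedTensor R X M) :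
    equivTensorProduct Y M (map R M f t) = g.rTensor M (equivTensorProduct X M t) := by
  refine DFunLike.congr_fun (hom_ext (R := R)
    (g := (equivTensorProduct Y M).toAddMonoidHom.comp (map R M f))
    (h := (g.rTensor M).toAddMonoidHom.comp (equivTensorProduct X M).toAddMonoidHom)
    fun x m => ?_) t
  exact congrArg (· ⊗ₜ[R] m) (hfg x)

theorem isFlatModule_of_flat (R : Type u) [CommRing R] (M : Type u) [AddCommGroup M] [Module R M]
    [Module.Flat R M] : IsFlatModule R M := by
  intro X Y _ _ _ _ f hf s t hst
  let _ : Module R X := Module.compHom X (RingEquiv.toOpposite R).toRingHom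
  let _ : Module R Y := Module.compHom Y (RingEquiv.toOpposite R).toRingHom
  have : IsCentralScalar R X := ⟨fun _ _ => rfl⟩
  have : IsCentralScalar R Y := ⟨fun _ _ => rfl⟩
  let g : X →ₗ[R] Y := { f with map_smul' := fun r x => f.map_smul (MulOpposite.op r) x }
  refine (BalancedTensor.equivTensorProduct X M).injective
    (Module.Flat.rTensor_preserves_injective_linearMap g hf ?_)
  rw [← BalancedTensor.equivTensorProduct_map f g fun _ => rfl,
    ← BalancedTensor.equivTensorProduct_map f g fun _ => rfl, hst]

/-! ### Elementary duality -/

/-- The left formula `∃ z (x = D z ∧ C z = 0)` dual to the right formula `∃ y (y C = x D)`: the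
first row of the system is `D z = x`, the others are `C z = 0`. -/
def PPFormula.dual {R : Type u} [Ring R] (ψ : PPFormula Rᵐᵒᵖ 1) : PPFormula R 1 where
  rows := ψ.bound + 1
  bound := ψ.rows
  A := Fin.cons (fun i => (ψ.B i 0).unop) (fun j i => (ψ.A i j).unop)
  B := Fin.cons (fun _ => 1) (fun _ _ => 0)

theorem PPFormula.mem_dual_solutions_iff {R : Type u} [Ring R] (ψ : PPFormula Rᵐᵒᵖ 1)
    {M : Type v} [AddCommGroup M] [Module R M] {a : M} :
    a ∈ ψ.dual.solutions M ↔ ∃ z : Fin ψ.rows → M, ∑ i, (ψ.B i 0).unop • z i = a ∧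
      ∀ j, ∑ i, (ψ.A i j).unop • z i = 0 := by
  rw [PPFormula.mem_solutions_iff]
  refine exists_congr fun z => ?_
  change (∀ k : Fin (ψ.bound + 1), _) ↔ _
  rw [Fin.forall_fin_succ]
  simp only [PPFormula.dual, Fin.cons_zero, Fin.cons_succ, one_smul, zero_smul]
  rfl

theorem BalancedTensor.tmul_eq_zero_of_mem_dual_solutions {R : Type u} [Ring R] {X : Type v}
    {M : Type w} [AddCommGroup X] [Module Rᵐᵒᵖ X] [AddCommGroup M] [Module R M]
    {ψ : PPFormula Rᵐᵒᵖ 1} {x : X} {m : M} (hx : x ∈ ψ.solutions X)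
    (hm : m ∈ ψ.dual.solutions M) : tmul R x m = 0 := by
  obtain ⟨y, hy⟩ := ψ.mem_solutions_iff.1 hx
  obtain ⟨z, rfl, hz⟩ := ψ.mem_dual_solutions_iff.1 hm
  calc tmul R x (∑ i, (ψ.B i 0).unop • z i) = ∑ i, tmul R (∑ j, ψ.A i j • y j) (z i) := by
        simp only [map_sum, tmul_smul, MulOpposite.op_unop, hy]
    _ = ∑ j, tmul R (y j) (∑ i, (ψ.A i j).unop • z i) := by
        simp only [map_sum, AddMonoidHom.finsetSum_apply, tmul_smul, MulOpposite.op_unop]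
        exact Finset.sum_comm
    _ = 0 := by simp only [hz, map_zero, Finset.sum_const_zero]

theorem PPFormula.IsHigh.dual_isLow {R : Type u} [Ring R] {ψ : PPFormula Rᵐᵒᵖ 1}
    (hψ : ψ.IsHigh) : ψ.dual.IsLow := by
  intro F _ _ hF
  obtain ⟨E, _, _, i, hi, hE⟩ := exists_injective_linearMap_to_injective Rᵐᵒᵖ R
  have h_one : i 1 ∈ ψ.solutions E := hψ E (.of_injective hE) ▸ Set.mem_univ _
  refine Set.Subset.antisymm (fun m hm => ?_) ?_
  · have h : BalancedTensor.map R F i (BalancedTensor.tmul R 1 m) = 0 :=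
      (BalancedTensor.map_tmul R i 1 m).trans
        (BalancedTensor.tmul_eq_zero_of_mem_dual_solutions h_one hm)
    have h_tmul : BalancedTensor.tmul R (1 : R) m = 0 := hF R E i hi (h.trans (map_zero _).symm)
    exact BalancedTensor.one_tmul_injective R F (h_tmul.trans (map_zero _).symm)
  · rintro _ rfl
    exact ψ.mem_dual_solutions_iff.2 ⟨0, by simp⟩

theorem PPFormula.dual_isConsistentAt {R : Type u} [Ring R] {ψ : PPFormula Rᵐᵒᵖ 1}
    (hψ : ψ.solutions Rᵐᵒᵖ = {0}) {M : Type v} [AddCommGroup M] [Module R M] (x : Fin 1 → M) :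
    ψ.dual.IsConsistentAt x := by
  intro (r : Fin (ψ.bound + 1) → R) hr
  have hrel (i) : r 0 * (ψ.B i 0).unop + ∑ j : Fin ψ.bound, r j.succ * (ψ.A i j).unop = 0 :=
    (Fin.sum_univ_succ _).symm.trans (congrFun hr i)
  have hsol : MulOpposite.op (r 0) ∈ ψ.solutions Rᵐᵒᵖ := by
    refine ψ.mem_solutions_iff.2 ⟨fun j => MulOpposite.op (-r j.succ), fun i => ?_⟩
    apply MulOpposite.unop_injective
    simpa using neg_eq_of_add_eq_zero_left (hrel i)
  have hr0 : r 0 = 0 := by simpa [hψ] using hsol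
  refine (Fin.sum_univ_succ (n := ψ.bound) _).trans ?_
  simp [hr0, PPFormula.dual]

theorem PPFormula.IsLow.dual_isHigh {R : Type u} [Ring R] {ψ : PPFormula Rᵐᵒᵖ 1}
    (hψ : ψ.IsLow) : ψ.dual.IsHigh := fun _ _ _ hN =>
  Set.eq_univ_of_forall fun _ =>
    hN.realize (PPFormula.dual_isConsistentAt (hψ _ (isFlatModule_self Rᵐᵒᵖ)) _)

theorem PPFormula.IsHighLow.dual {R : Type u} [Ring R] {ψ : PPFormula Rᵐᵒᵖ 1}
    (hψ : ψ.IsHighLow) : ψ.dual.IsHighLow :=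
  ⟨hψ.2.dual_isHigh, hψ.1.dual_isLow⟩

theorem hasNoHighLowFormula_iff_left {R : Type u} [Ring R] :
    HasNoHighLowFormula R ↔ ∀ φ : PPFormula R 1, ¬ φ.IsHighLow :=
  ⟨And.left, fun h => ⟨h, fun ψ hψ => h ψ.dual hψ.dual⟩⟩

/-! ### Rational extensions -/

theorem IsRationalExtension.exists_smul_mem_range {R : Type u} [Ring R] {A : Type v} {B : Type w}
    [AddCommGroup A] [Module Rᵐᵒᵖ A] [AddCommGroup B] [Module Rᵐᵒᵖ B] {f : A →ₗ[Rᵐᵒᵖ] B}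
    (hf : IsRationalExtension f) {t : Set B} (ht : t.Finite) {b : B} (hb : b ≠ 0) :
    ∃ s : R, MulOpposite.op s • b ≠ 0 ∧ ∀ y ∈ t, MulOpposite.op s • y ∈ LinearMap.range f := by
  induction t, ht using Set.Finite.induction_on with
  | empty => exact ⟨1, by simpa using hb, by simp⟩
  | @insert y t _ _ ih =>
    obtain ⟨s, hsb, hst⟩ := ih
    obtain ⟨s', hsb', hsy⟩ := hf.2 (MulOpposite.op s • y) _ hsb
    refine ⟨s * s', ?_, ?_⟩
    · rwa [MulOpposite.op_mul, mul_smul]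
    · simp only [MulOpposite.op_mul, mul_smul, Set.forall_mem_insert]
      exact ⟨hsy, fun z hz => Submodule.smul_mem _ _ (hst z hz)⟩

/-- Multiplying on the right by a common denominator of the witnesses in `N` moves a solution
into `R`. -/
theorem IsRationalExtension.exists_ne_zero_mem_solutions {R : Type u} [Ring R] [Nontrivial R]
    {N : Type v} [AddCommGroup N] [Module R N] [Module Rᵐᵒᵖ N] [SMulCommClass R Rᵐᵒᵖ N]
    {f : R →ₗ[Rᵐᵒᵖ] N} (hf : IsRationalExtension f) (hf_one : ∀ r, f r = r • f 1)
    {φ : PPFormula R 1} (h : f 1 ∈ φ.solutions N) : ∃ s ∈ φ.solutions R, s ≠ 0 := by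
  obtain ⟨y, hy⟩ := φ.mem_solutions_iff.1 h
  have hf_one_ne : f 1 ≠ 0 := (map_ne_zero_iff f hf.1).2 one_ne_zero
  obtain ⟨s, hs, hsy⟩ := hf.exists_smul_mem_range (Set.finite_range y) hf_one_ne
  choose r hr using fun j => hsy (y j) (Set.mem_range_self j)
  have hf_left (a b : R) : f (a * b) = a • f b := by rw [hf_one, mul_smul, ← hf_one]
  have hfs : f s = MulOpposite.op s • f 1 := by simp [← map_smul]
  refine ⟨s, φ.mem_solutions_iff.2 ⟨r, fun i => hf.1 ?_⟩, ?_⟩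
  · calc f (∑ j, φ.A i j • r j) = MulOpposite.op s • ∑ j, φ.A i j • y j := by
          simp only [map_sum, smul_eq_mul, hf_left, hr, Finset.smul_sum,
            smul_comm (φ.A i _) (MulOpposite.op s)]
      _ = f (φ.B i 0 • s) := by
          rw [hy, ← smul_comm (φ.B i 0), ← hfs, smul_eq_mul, hf_left]
  · rintro rfl
    exact hs (by simp)

instance RestrictAlong.instSMulCommClass {R : Type u} {Q : Type v} [Ring R] [Ring Q]
    (f : R →+* Q) : SMulCommClass R Rᵐᵒᵖ (RestrictAlong f) :=
  ⟨fun r s q => (mul_assoc (f r) q (f s.unop)).symm⟩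

theorem RestrictAlong.rightMap_eq_smul {R : Type u} {Q : Type v} [Ring R] [Ring Q]
    (f : R →+* Q) (r : R) : rightMap f r = r • rightMap f 1 := by
  change f r = f r * f 1
  rw [map_one, mul_one]

/-! ### Essential submodules and nonsingular modules -/

theorem IsEssentialSubmodule.comap {S : Type u} [Ring S] {M : Type v} {N : Type w}
    [AddCommGroup M] [Module S M] [AddCommGroup N] [Module S N] {L : Submodule S N}
    (hL : IsEssentialSubmodule L) (f : M →ₗ[S] N) : IsEssentialSubmodule (L.comap f) := by
  intro K hK
  have hmap : K.map f = ⊥ := by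
    refine hL _ ((Submodule.eq_bot_iff _).2 ?_)
    rintro _ ⟨hxL, x, hx, rfl⟩
    have : x ∈ L.comap f ⊓ K := ⟨hxL, hx⟩
    rw [hK, Submodule.mem_bot] at this
    rw [this, map_zero]
  rw [← hK, eq_comm, inf_eq_right]
  intro x hx
  have : f x ∈ K.map f := Submodule.mem_map_of_mem hx
  rw [hmap, Submodule.mem_bot] at this
  simp [this]

theorem IsEssentialSubmodule.mono {S : Type u} [Ring S] {M : Type v} [AddCommGroup M]
    [Module S M] {L L' : Submodule S M} (hL : IsEssentialSubmodule L) (h : L ≤ L') :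
    IsEssentialSubmodule L' :=
  fun K hK => hL K (le_bot_iff.1 (hK ▸ inf_le_inf_right K h))

theorem IsEssentialSubmodule.exists_smul_mem {S : Type u} [Ring S] {M : Type v} [AddCommGroup M]
    [Module S M] {L : Submodule S M} (hL : IsEssentialSubmodule L) {x : M} (hx : x ≠ 0) :
    ∃ s : S, s • x ≠ 0 ∧ s • x ∈ L := by
  by_contra! hcon
  refine hx ?_
  have h := hL (S ∙ x) ((Submodule.eq_bot_iff _).2 ?_)
  · simpa using h
  · rintro _ ⟨hy, hy'⟩
    obtain ⟨s, rfl⟩ := Submodule.mem_span_singleton.1 hy'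
    by_contra h0
    exact hcon s h0 hy

theorem IsNonsingularModule.of_essential_range {S : Type u} [Ring S] {A : Type v} {E : Type w}
    [AddCommGroup A] [Module S A] [AddCommGroup E] [Module S E] (hA : IsNonsingularModule S A)
    {f : A →ₗ[S] E} (hf : Function.Injective f)
    (hess : IsEssentialSubmodule (LinearMap.range f)) : IsNonsingularModule S E := by
  intro x hx hxess
  obtain ⟨s, hs, a, ha⟩ := hess.exists_smul_mem hx
  have ha_ne : a ≠ 0 := by
    rintro rfl
    exact hs (by rw [← ha, map_zero])
  refine hA a ha_ne ((hxess.comap (LinearMap.toSpanSingleton S S s)).mono fun t ht => ?_)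
  rw [Ideal.mem_torsionOf_iff]
  apply hf
  rw [map_smul, ha, map_zero, ← mul_smul]
  exact ht

theorem IsNonsingularModule.isRationalExtension {R : Type u} [Ring R] {A : Type v} {B : Type w}
    [AddCommGroup A] [Module Rᵐᵒᵖ A] [AddCommGroup B] [Module Rᵐᵒᵖ B]
    (hA : IsNonsingularModule Rᵐᵒᵖ A) {f : A →ₗ[Rᵐᵒᵖ] B} (hf : Function.Injective f)
    (hess : IsEssentialSubmodule (LinearMap.range f)) : IsRationalExtension f := by
  refine ⟨hf, fun b₀ b₁ hb₁ => ?_⟩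
  have hB : IsNonsingularModule Rᵐᵒᵖ B := hA.of_essential_range hf hess
  by_contra! hann
  refine hB b₁ hb₁ ((hess.comap (LinearMap.toSpanSingleton Rᵐᵒᵖ _ b₀)).mono fun s hs => ?_)
  rw [Ideal.mem_torsionOf_iff]
  by_contra hne
  exact hann s.unop hne hs

/-! ### Commutative rings -/

theorem isReduced_of_isNonsingularModule {R : Type u} [CommRing R]
    (h : IsNonsingularModule R R) : IsReduced R := by
  rw [isReduced_iff_pow_one_lt 2 one_lt_two]
  intro x hx
  by_contra hx0
  refine h x hx0 fun K hK => (Submodule.eq_bot_iff _).2 fun a ha => ?_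
  have hmul {b : R} (hb : b ∈ K) (hbx : b * x = 0) : b = 0 :=
    (Submodule.mem_bot R).1 (hK ▸ ⟨(Ideal.mem_torsionOf_iff x b).2 hbx, hb⟩)
  have hxa : x * a = 0 := hmul (K.smul_mem x ha) (by rw [mul_right_comm, ← sq, hx, zero_mul])
  exact hmul ha (by rw [mul_comm, hxa])

theorem exists_nontrivial_isFlatModule_isAbsolutelyPure (R : Type u) [CommRing R] [Nontrivial R]
    [IsReduced R] : ∃ (K : Type u) (_ : AddCommGroup K) (_ : Module R K),
      Nontrivial K ∧ IsFlatModule R K ∧ IsAbsolutelyPure R K := by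
  obtain ⟨p, hp⟩ := Ideal.nonempty_minimalPrimes (bot_ne_top (α := Ideal R))
  have : p.IsPrime := hp.1.1
  let K := Localization.AtPrime p
  have : Ring.KrullDimLE 0 K := .of_isLocalization p hp K
  let _ : Field K := Ring.KrullDimLE.isField_of_isReduced.toField
  have : Module.Injective K K := Module.injective_of_isSemisimpleRing K K
  have : Module.Flat R K := IsLocalization.flat K p.primeCompl
  exact ⟨K, inferInstance, inferInstance, inferInstance, isFlatModule_of_flat R K,
    .of_injective (injective_of_flat_algebra (S := K) K)⟩

theorem mainTheorem10_general :
    (∀ (R N : Type u) [Ring R] [Nontrivial R] [AddCommGroup N] [Module R N] [Module Rᵐᵒᵖ N]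
      [SMulCommClass R Rᵐᵒᵖ N] (f : R →ₗ[Rᵐᵒᵖ] N),
      IsRationalExtension f →
      (∀ r, f r = r • f 1) →
      IsAbsolutelyPure R N →
      HasNoHighLowFormula R) ∧
    (∀ (R K : Type u) [Ring R] [AddCommGroup K] [Module R K] [Nontrivial K],
      IsFlatModule R K →
      IsAbsolutelyPure R K →
      HasNoHighLowFormula R) := by
  refine ⟨fun R N _ _ _ _ _ _ f hf hf_one hN => hasNoHighLowFormula_iff_left.2 fun φ hφ => ?_,
    fun R K _ _ _ _ hflat hK => hasNoHighLowFormula_iff_left.2 fun φ hφ => ?_⟩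
  · have h_one : f 1 ∈ φ.solutions N := hφ.1 N hN ▸ Set.mem_univ _
    obtain ⟨s, hs, hs_ne⟩ := hf.exists_ne_zero_mem_solutions hf_one h_one
    rw [hφ.2 R (isFlatModule_self R)] at hs
    exact hs_ne hs
  · obtain ⟨a, ha⟩ := exists_ne (0 : K)
    have ha_sol : a ∈ φ.solutions K := hφ.1 K hK ▸ Set.mem_univ _
    rw [hφ.2 K hflat] at ha_sol
    exact ha ha_sol

theorem mainTheorem10 :
    (∀ (R Q : Type u) [Ring R] [Nontrivial R] [Ring Q] (f : R →+* Q),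
      IsRationalExtension (RestrictAlong.rightMap f) →
      IsAbsolutelyPure R (RestrictAlong f) →
      HasNoHighLowFormula R) ∧
    (∀ (R Q : Type u) [Ring R] [Nontrivial R] [Ring Q] (f : R →+* Q),
      IsRightNonsingular R →
      IsMaximalRightQuotientRing f →
      IsAbsolutelyPure R (RestrictAlong f) →
      HasNoHighLowFormula R) ∧
    (∀ (R : Type u) [CommRing R] [Nontrivial R],
      IsNonsingularModule R R →
      HasNoHighLowFormula R) := by
  obtain ⟨h_rational, h_flat⟩ := mainTheorem10_general.{u}
  refine ⟨fun R Q _ _ _ f hf => h_rational R _ _ hf (RestrictAlong.rightMap_eq_smul f),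
    fun R Q _ _ _ f hR hf => h_rational R _ _ (hR.isRationalExtension hf.1 hf.2.1)
      (RestrictAlong.rightMap_eq_smul f), fun R _ _ hR => ?_⟩
  have := isReduced_of_isNonsingularModule hR
  obtain ⟨K, _, _, _, hflat, hpure⟩ := exists_nontrivial_isFlatModule_isAbsolutelyPure R
  exact h_flat R K hflat hpure
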